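/- Let $n \ge 2$ and let $\Pi_n$ be the lattice of set partitions of $[n]=\{1,\dots,n\}$ ordered by refinement ($\pi\le\pi'$ if every block of $\pi$ is contained in a block of $\pi'$). For a bounded poset $P$ let $\overline P = P\setminus\{\hat 0,\hat 1\}$ be its proper part, and let $\widetilde H_i(\overline P)$ be the reduced simplicial homology, with integer coefficients, of the order complex of $\overline P$ (so $\widetilde H_{-1}(\emptyset)=\mathbb Z$). For a permutation $\omega\in S_n$ and positions $i_1<\dots<i_k$ in $[n-1]$, splitting $\omega$ at these positions gives the partition of $[n]$ with the $k+1$ blocks $$\{\omega(1),\dots,\omega(i_1)\},\ \{\omega(i_1+1),\dots,\omega(i_2)\},\ \dots,\ \{\omega(i_k+1),\dots,\omega(n)\}.$$ Let $\Pi_\omega$ be the induced subposet of $\Pi_n$ consisting of all partitions obtained by splitting $\omega$; it contains the bottom and the top element of $\Pi_n$. Then for every $\omega\in S_n$ the group $\widetilde H_{n-3}(\overline\Pi_\omega)$ is infinite cyclic, so that $\overline\Pi_\omega$ has a fundamental cycle, i.e. a generator $\rho_\omega$ of this group, unique up to sign. For any choice of these generators, the images in $\widetilde H_{n-3}(\overline\Pi_n)$,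 under the map induced by the inclusion $\overline\Pi_\omega\subseteq\overline\Pi_n$, of the cycles $$\rho_\omega,\qquad \omega\in S_n,\ \omega(n)=n,$$ indexed by these permutations, form a basis of the free abelian group $\widetilde H_{n-3}(\overline\Pi_n)$. -/

import Mathlib

namespace SplittingBasis

/-! ### Proper parts and reduced homology of posets -/

/-- The proper part of a bounded poset: remove the bottom and the top element. -/
abbrev ProperPart (P : Type*) [PartialOrder P] [BoundedOrder P] : Type _ :=
  {x : P // x ≠ ⊥ ∧ x ≠ ⊤}

/-- The group of integral simplicial chains of dimension `m - 1` of the order complex of `P`: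
the free abelian group on the chains `x₀ < ⋯ < x_{m-1}` with `m` elements. For `m = 0` the only
generator is the empty chain, so this is the augmented chain complex. -/
abbrev Chains (P : Type*) [PartialOrder P] (m : ℕ) : Type _ :=
  (Fin m ↪o P) →₀ ℤ

/-- The simplicial boundary, sending `x₀ < ⋯ < x_m` to
`∑ i, (-1) ^ i • (x₀ < ⋯ < x_{i-1} < x_{i+1} < ⋯ < x_m)`. For `m = 0` it is the augmentation. -/
noncomputable def boundary (P : Type*) [PartialOrder P] (m : ℕ) :
    Chains P (m + 1) →ₗ[ℤ] Chains P m :=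
  Finsupp.linearCombination ℤ fun c : Fin (m + 1) ↪o P =>
    ∑ i : Fin (m + 1),
      (-1 : ℤ) ^ (i : ℕ) • Finsupp.single ((Fin.succAboveOrderEmb i).trans c) (1 : ℤ)

/-- The reduced cycles of dimension `m - 1`. -/
noncomputable def cycles (P : Type*) [PartialOrder P] : (m : ℕ) → Submodule ℤ (Chains P m)
  | 0 => ⊤
  | m + 1 => LinearMap.ker (boundary P m)

/-- The boundaries of dimension `m - 1`. -/
noncomputable def boundaries (P : Type*) [PartialOrder P] (m : ℕ) : Submodule ℤ (Chains P m) :=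
  LinearMap.range (boundary P m)

/-- The reduced simplicial homology group, with integer coefficients and in degree `m - 1`, of the
order complex of the poset `P` (cycles modulo boundaries). -/
abbrev ReducedHomology (P : Type*) [PartialOrder P] (m : ℕ) : Type _ :=
  cycles P m ⧸ (boundaries P m).submoduleOf (cycles P m)

section Functoriality

variable {P Q : Type*} [PartialOrder P] [PartialOrder Q]

/-- The map on chains induced by an order embedding of posets. -/
noncomputable def chainsMap (f : P ↪o Q) (m : ℕ) : Chains P m →ₗ[ℤ] Chains Q m :=
  Finsupp.lmapDomain ℤ ℤ fun c : Fin m ↪o P => c.trans f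

theorem boundary_chainsMap (f : P ↪o Q) (m : ℕ) (x : Chains P (m + 1)) :
    boundary Q m (chainsMap f (m + 1) x) = chainsMap f m (boundary P m x) := by
  have h : (boundary Q m).comp (chainsMap f (m + 1)) = (chainsMap f m).comp (boundary P m) := by
    refine Finsupp.lhom_ext fun c a => ?_
    simp only [boundary, chainsMap, LinearMap.comp_apply, Finsupp.lmapDomain_apply,
      Finsupp.mapDomain_single, Finsupp.linearCombination_single, map_smul, map_sum]
    rfl
  exact LinearMap.congr_fun h x

theorem chainsMap_mem_cycles (f : P ↪o Q) :
    ∀ (m : ℕ), ∀ x ∈ cycles P m, chainsMap f m x ∈ cycles Q m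
  | 0, _, _ => Submodule.mem_top
  | m + 1, x, hx => by
    have hx' : boundary P m x = 0 := hx
    change boundary Q m _ = 0
    rw [boundary_chainsMap, hx', map_zero]

/-- The map in reduced homology induced by an order embedding of posets. -/
noncomputable def homologyMap (f : P ↪o Q) (m : ℕ) :
    ReducedHomology P m →ₗ[ℤ] ReducedHomology Q m :=
  Submodule.mapQ _ _ ((chainsMap f m).restrict (chainsMap_mem_cycles f m)) (by
    rintro ⟨x, _⟩ ⟨y, hy⟩
    exact ⟨chainsMap f (m + 1) y,
      (boundary_chainsMap f m y).trans (congrArg (chainsMap f m) hy)⟩)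

end Functoriality

/-- `z` is a fundamental cycle, in degree `m - 1`, of a poset whose order complex is an
`(m - 1)`-sphere: the homology group in that degree is infinite cyclic and `z` is a generator
of it. Such a `z` is unique up to sign. -/
def IsFundamentalCycle {P : Type*} [PartialOrder P] {m : ℕ} (z : ReducedHomology P m) : Prop :=
  ∃ e : ReducedHomology P m ≃ₗ[ℤ] ℤ, e z = 1

/-! ### The partition lattice and splittings of permutations -/

/-- The lattice of partitions of an `n`-element set, a partition being given by the equivalence
relation whose classes are its blocks; `π ≤ π'` means that `π` refines `π'`. -/
abbrev PartitionLattice (n : ℕ) : Type := Setoid (Fin n)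

/-- The partition obtained by splitting the word `ω 0, ω 1, …, ω (n - 1)` at the positions in `S`,
where the position `s` separates `ω 0, …, ω s` from `ω (s + 1), …, ω (n - 1)`: two letters are in
the same block if and only if no position in `S` separates them. -/
def split {n : ℕ} (ω : Equiv.Perm (Fin n)) (S : Set (Fin (n - 1))) : PartitionLattice n where
  r a b := ∀ s ∈ S, ((ω.symm a : ℕ) ≤ (s : ℕ) ↔ (ω.symm b : ℕ) ≤ (s : ℕ))
  iseqv :=
    ⟨fun _ _ _ => Iff.rfl, fun h s hs => (h s hs).symm, fun h h' s hs => (h s hs).trans (h' s hs)⟩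

/-- The induced subposet of the partition lattice that consists of all partitions obtained by
splitting `ω`. -/
abbrev SplitPoset {n : ℕ} (ω : Equiv.Perm (Fin n)) : Type :=
  {π : PartitionLattice n // ∃ S : Set (Fin (n - 1)), split ω S = π}

theorem split_univ {n : ℕ} (ω : Equiv.Perm (Fin n)) : split ω Set.univ = ⊥ := by
  refine le_antisymm ?_ bot_le
  intro a b h
  have h' : ∀ s : Fin (n - 1), ((ω.symm a : ℕ) ≤ (s : ℕ) ↔ (ω.symm b : ℕ) ≤ (s : ℕ)) :=
    fun s => h s (Set.mem_univ s)
  have hab : (ω.symm a : ℕ) = (ω.symm b : ℕ) := by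
    have ha := (ω.symm a).isLt
    have hb := (ω.symm b).isLt
    rcases lt_trichotomy (ω.symm a : ℕ) (ω.symm b : ℕ) with hlt | heq | hlt
    · have := h' ⟨ω.symm a, by omega⟩
      simp only [le_refl, true_iff] at this
      omega
    · exact heq
    · have := h' ⟨ω.symm b, by omega⟩
      simp only [le_refl, iff_true] at this
      omega
  exact ω.symm.injective (Fin.ext hab)

theorem split_empty {n : ℕ} (ω : Equiv.Perm (Fin n)) : split ω ∅ = ⊤ :=
  le_antisymm le_top fun _ _ _ s hs => absurd hs (Set.notMem_empty s)

instance {n : ℕ} (ω : Equiv.Perm (Fin n)) : BoundedOrder (SplitPoset ω) where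
  top := ⟨⊤, ∅, split_empty ω⟩
  le_top π := le_top (a := π.1)
  bot := ⟨⊥, Set.univ, split_univ ω⟩
  bot_le π := bot_le (a := π.1)

/-- The inclusion of the proper part of the poset of splittings of `ω` into the proper part of the
partition lattice. -/
def properInclusion {n : ℕ} (ω : Equiv.Perm (Fin n)) :
    ProperPart (SplitPoset ω) ↪o ProperPart (PartitionLattice n) where
  toFun π := ⟨π.1.1, fun h => π.2.1 (Subtype.ext h), fun h => π.2.2 (Subtype.ext h)⟩
  inj' _ _ h := Subtype.ext (Subtype.ext (congrArg (fun x => x.1) h))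
  map_rel_iff' := Iff.rfl

end SplittingBasis

/-!
Write `n = m + 2`. Chains in the proper part of the partition lattice have at most `m = n - 2`
elements, so there are no boundaries in degree `n - 3`: homology there is the group of
top-dimensional cycles, and a cycle may be studied through its coefficients at maximal chains.

Fix a letter `a`. For a word `ω` ending in `a`, the flag chain of `ω` is the maximal chain whose
members have as only nontrivial block a final segment of `ω`, one letter longer at every step.
These `(n - 1)!` chains detect everything:

* A top-dimensional cycle that vanishes on all flag chains for `a` is zero
  (`eq_zero_of_apply_flagChain_eq_zero`). Otherwise take a chain `c` in its support for which the
  blocks of `a` have the largest total size. If the block of `a` grows at every step, then `c` is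
  a flag chain. If not, some step leaves it unchanged and the next one enlarges it; every other
  chain sharing with `c` all elements but the one between these two steps has a larger block of
  `a` there (`block_ssubset_of_ne`), hence lies outside the support, and the vanishing of the
  boundary at the common face forces the coefficient at `c` to be zero.
* The flag chain of `ω` is the only flag chain, among those for the last letter of `ω`, that
  consists of splittings of `ω` (`eq_of_flagChain_eq_trans`).

A cycle of splittings of `ω` is therefore determined by its coefficient at the flag chain of `ω`.
The alternating sum over all orders in which the split positions can be given up is a cycle with
coefficient `1` there (`splitCycle_mem_cycles`), so the homology of the poset of splittings is
infinite cyclic, and a fundamental cycle has coefficient `1` or `-1`. Evaluation at the flag chains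
for `a` is then an injective map from the top homology of the partition lattice to a free abelian
group, and it sends the classes of the fundamental cycles to the standard basis up to signs; so
these classes form a basis.
-/

namespace SplittingBasis

/-! ### The rank of a partition and saturated chains -/

theorem card_quotient_lt {n : ℕ} {r s : PartitionLattice n} (h : r < s) :
    Nat.card (Quotient s) < Nat.card (Quotient r) := by
  let f : Quotient r → Quotient s := Quotient.map' id fun _ _ hab => h.le hab
  have hf : Function.Surjective f := fun q => by
    induction q using Quotient.inductionOn with
    | _ a => exact ⟨Quotient.mk r a, rfl⟩
  refine lt_of_le_of_ne (Nat.card_le_card_of_surjective f hf) fun hc => h.not_ge fun a b hab => ?_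
  have hinj : Function.Injective f :=
    (Nat.bijective_iff_surjective_and_card f).2 ⟨hf, hc.symm⟩ |>.1
  exact Quotient.exact (hinj (Quotient.sound hab : f (Quotient.mk r a) = f (Quotient.mk r b)))

/-- The rank of a partition of an `n`-element set: `n` minus the number of blocks. -/
noncomputable def rank {n : ℕ} (r : PartitionLattice n) : ℕ := n - Nat.card (Quotient r)

theorem rank_strictMono (n : ℕ) : StrictMono (rank (n := n)) := fun r s h => by
  have h1 := card_quotient_lt h
  have h2 : Nat.card (Quotient r) ≤ Nat.card (Fin n) :=
    Nat.card_le_card_of_surjective (Quotient.mk r) Quotient.mk_surjective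
  rw [Nat.card_fin] at h2
  unfold rank
  omega

theorem rank_le {m : ℕ} (r : PartitionLattice (m + 2)) : rank r ≤ m + 1 := by
  have : 0 < Nat.card (Quotient r) := Nat.card_pos
  unfold rank
  omega

/-- A chain in the proper part of the partition lattice, extended by the bottom element at
position `0` and by the top element at all positions past its end. -/
@[reducible]
def extend {n l : ℕ} (c : Fin l ↪o ProperPart (PartitionLattice n)) : ℕ → PartitionLattice n
  | 0 => ⊥
  | k + 1 => if h : k < l then (c ⟨k, h⟩).1 else ⊤

section Extend

variable {m l : ℕ} (c : Fin l ↪o ProperPart (PartitionLattice (m + 2)))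

theorem extend_succ (i : Fin l) : extend c (i + 1) = (c i).1 := by
  simp [extend]

theorem extend_succ_of_le {k : ℕ} (h : l ≤ k) : extend c (k + 1) = ⊤ :=
  dif_neg h.not_gt

theorem extend_last : extend c (l + 1) = ⊤ := extend_succ_of_le c le_rfl

theorem extend_lt_succ {k : ℕ} (hk : k ≤ l) : extend c k < extend c (k + 1) := by
  have htop : ∀ k, ⊥ < extend c (k + 1) := fun k => by
    by_cases h : k < l
    · rw [extend_succ c ⟨k, h⟩]
      exact bot_lt_iff_ne_bot.2 (c ⟨k, h⟩).2.1
    · rw [extend_succ_of_le c (not_lt.1 h)]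
      exact lt_of_le_not_ge bot_le fun hle =>
        zero_ne_one (hle trivial : (⊥ : PartitionLattice (m + 2)) 0 1)
  cases k with
  | zero => exact htop 0
  | succ k =>
    rw [extend_succ c ⟨k, hk⟩]
    rcases hk.eq_or_lt with h | h
    · rw [h, extend_last]
      exact lt_top_iff_ne_top.2 (c ⟨k, hk⟩).2.2
    · rw [extend_succ c ⟨k + 1, h⟩]
      exact c.strictMono (Fin.mk_lt_mk.2 (Nat.lt_succ_self k))

theorem rank_extend_add_le {k d : ℕ} (h : k + d ≤ l + 1) :
    rank (extend c k) + d ≤ rank (extend c (k + d)) := by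
  induction d with
  | zero => exact le_rfl
  | succ d ih =>
    have h1 := ih (by omega)
    have h2 := rank_strictMono _ (extend_lt_succ c (show k + d ≤ l by omega))
    rw [← Nat.add_assoc k d 1]
    omega

end Extend

theorem length_le {m l : ℕ} (c : Fin l ↪o ProperPart (PartitionLattice (m + 2))) :
    l ≤ m := by
  have h1 := rank_extend_add_le c (show 0 + (l + 1) ≤ l + 1 by omega)
  have h2 := rank_le (extend c (0 + (l + 1)))
  omega

/-- A chain with `m` elements in the proper part of the partition lattice of an
`(m + 2)`-element set is saturated. -/
theorem rank_extend {m : ℕ} (c : Fin m ↪o ProperPart (PartitionLattice (m + 2))) {k : ℕ}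
    (hk : k ≤ m + 1) : rank (extend c k) = k := by
  obtain ⟨d, hd⟩ := Nat.exists_eq_add_of_le hk
  have h1 := rank_extend_add_le c (show 0 + k ≤ m + 1 by omega)
  have h2 := rank_extend_add_le c hd.ge
  have h3 := rank_le (extend c (k + d))
  rw [Nat.zero_add] at h1
  omega

/-! ### Chains of splittings of a permutation -/

section Splittings

variable {m : ℕ} (ω : Equiv.Perm (Fin (m + 2)))

theorem split_le_split_iff {S T : Set (Fin (m + 1))} :
    split ω S ≤ split ω T ↔ T ⊆ S := by
  refine ⟨fun h s hs => ?_, fun h a b hab s hs => hab s (h hs)⟩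
  by_contra hS
  have h1 : split ω S (ω s.castSucc) (ω s.succ) := fun t ht => by
    have : (s : ℕ) ≠ t := fun e => hS (Fin.ext e ▸ ht)
    simp only [Equiv.symm_apply_apply, Fin.val_castSucc, Fin.val_succ]
    omega
  have h2 := h h1 s hs
  simp at h2

theorem split_injective : Function.Injective (split ω) := fun _ _ h =>
  ((split_le_split_iff ω).1 h.ge).antisymm ((split_le_split_iff ω).1 h.le)

/-- The maximal chain of splittings of `ω` in which the `m + 1` split positions are given up one
after another, in the order of decreasing value of `σ`. -/
def splitChain (σ : Equiv.Perm (Fin (m + 1))) : Fin m ↪o ProperPart (SplitPoset ω) :=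
  OrderEmbedding.ofStrictMono
    (fun i => ⟨⟨split ω {s | (i : ℕ) + σ s < m}, _, rfl⟩, by
      have hi := i.isLt
      constructor <;> intro h
      · have h1 : split ω {s | (i : ℕ) + σ s < m} = split ω Set.univ :=
          (congrArg Subtype.val h).trans (split_univ ω).symm
        have h2 : σ.symm (Fin.last m) ∈ {s | (i : ℕ) + σ s < m} :=
          split_injective ω h1 ▸ Set.mem_univ _
        simp at h2
      · have h1 : split ω {s | (i : ℕ) + σ s < m} = split ω ∅ :=
          (congrArg Subtype.val h).trans (split_empty ω).symm
        have h2 : σ.symm 0 ∈ {s | (i : ℕ) + σ s < m} := by simp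
        exact (split_injective ω h1 ▸ h2 : σ.symm 0 ∈ (∅ : Set _))⟩)
    fun i j hij => by
      have hij' : (i : ℕ) < j := hij
      have hj := j.isLt
      refine lt_of_le_not_ge ((split_le_split_iff ω).2 fun s hs => ?_) fun h => ?_
      · change (i : ℕ) + σ s < m
        change (j : ℕ) + σ s < m at hs
        omega
      · have h1 := (split_le_split_iff ω).1 h
          (show σ.symm ⟨m - 1 - i, by omega⟩ ∈ {s | (i : ℕ) + σ s < m} by simp; omega)
        simp at h1
        omega

theorem splitChain_injective : Function.Injective (splitChain ω) := fun σ τ h => by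
  have key : ∀ (s) (i : ℕ), i < m → (i + (σ s : ℕ) < m ↔ i + (τ s : ℕ) < m) := fun s i hi => by
    have h1 : split ω {s | i + (σ s : ℕ) < m} = split ω {s | i + (τ s : ℕ) < m} :=
      congrArg (fun c => (c ⟨i, hi⟩).1.1) h
    exact Set.ext_iff.1 (split_injective ω h1) s
  refine Equiv.ext fun s => Fin.ext ?_
  have h1 := key s (m - 1 - σ s)
  have h2 := key s (m - 1 - τ s)
  have := (σ s).isLt
  have := (τ s).isLt
  omega

/-- The alternating sum of the chains of splittings of `ω`: the fundamental cycle of the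
barycentric subdivision of the boundary of a simplex. -/
noncomputable def splitCycle : Chains (ProperPart (SplitPoset ω)) m :=
  ∑ σ : Equiv.Perm (Fin (m + 1)),
    Finsupp.single (splitChain ω σ) ((Equiv.Perm.sign σ : ℤˣ) : ℤ)

theorem splitCycle_apply_one : splitCycle ω (splitChain ω 1) = 1 := by
  classical
  rw [splitCycle, Finsupp.finsetSum_apply, Finset.sum_eq_single 1]
  · simp
  · intro σ _ hσ
    exact Finsupp.single_eq_of_ne fun h => hσ (splitChain_injective ω h.symm)
  · simp

end Splittings

/-- Interchanging two consecutive values of `σ` changes a single element of the chain of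
splittings, so the faces of the alternating sum cancel in pairs. -/
theorem splitCycle_mem_cycles : ∀ {m : ℕ} (ω : Equiv.Perm (Fin (m + 2))),
    splitCycle ω ∈ cycles (ProperPart (SplitPoset ω)) m
  | 0, _ => Submodule.mem_top
  | m + 1, ω => by
    change boundary _ m (splitCycle ω) = 0
    simp only [splitCycle, map_sum, boundary, Finsupp.linearCombination_single, Finset.smul_sum]
    rw [Finset.sum_comm]
    refine Finset.sum_eq_zero fun i _ => ?_
    have hi := i.isLt
    set p : Fin (m + 2) := ⟨m - i, by omega⟩ with hp
    set q : Fin (m + 2) := ⟨m + 1 - i, by omega⟩ with hq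
    have hpq : p ≠ q := fun h => by simp [hp, hq] at h; omega
    refine Finset.sum_involution (fun σ _ => Equiv.swap p q * σ) (fun σ _ => ?_)
      (fun σ _ _ h => hpq (Equiv.swap_eq_one_iff.1 (mul_eq_right.1 h)))
      (fun _ _ => Finset.mem_univ _) fun σ _ => by rw [Equiv.swap_mul_self_mul]
    have hc : (Fin.succAboveOrderEmb i).trans (splitChain ω (Equiv.swap p q * σ)) =
        (Fin.succAboveOrderEmb i).trans (splitChain ω σ) := by
      refine RelEmbedding.ext fun k => Subtype.ext (Subtype.ext ?_)
      change split ω {s | ((i.succAbove k : Fin _) : ℕ) + (Equiv.swap p q (σ s) : ℕ) < m + 1} =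
        split ω {s | ((i.succAbove k : Fin _) : ℕ) + (σ s : ℕ) < m + 1}
      have hk : ((i.succAbove k : Fin _) : ℕ) ≠ i := fun h => Fin.succAbove_ne i k (Fin.ext h)
      congr 1
      ext s
      simp only [Set.mem_ofPred_eq]
      rcases eq_or_ne (σ s) p with h | h
      · rw [h, Equiv.swap_apply_left, hp, hq]
        simp only
        omega
      rcases eq_or_ne (σ s) q with h' | h'
      · rw [h', Equiv.swap_apply_right, hp, hq]
        simp only
        omega
      · rw [Equiv.swap_apply_of_ne_of_ne h h']
    rw [hc, Equiv.Perm.sign_mul, Equiv.Perm.sign_swap hpq]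
    simp

/-! ### Detecting top-dimensional cycles on flag chains -/

/-- If the chain `c` has an index `j` such that every other chain differing from `c` only in its
`j`-th element has coefficient zero in the cycle `z`, then so does `c`. -/
theorem apply_eq_zero_of_forall_ne {P : Type*} [PartialOrder P] {m : ℕ} {z : Chains P (m + 1)}
    (hz : z ∈ cycles P (m + 1)) (c : Fin (m + 1) ↪o P) (j : Fin (m + 1))
    (h : ∀ c' ≠ c, ∀ i, (Fin.succAboveOrderEmb i).trans c' = (Fin.succAboveOrderEmb j).trans c →
      z c' = 0) : z c = 0 := by
  classical
  have h0 : boundary P m z ((Fin.succAboveOrderEmb j).trans c) = 0 := by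
    rw [show boundary P m z = 0 from hz, Finsupp.zero_apply]
  rw [boundary, Finsupp.linearCombination_apply, Finsupp.sum, Finsupp.finsetSum_apply,
    Finset.sum_eq_single c] at h0
  · rw [Finsupp.smul_apply, Finsupp.finsetSum_apply, Finset.sum_eq_single j] at h0
    · simpa using h0
    · intro i _ hij
      rw [Finsupp.smul_apply, Finsupp.single_eq_of_ne, smul_zero]
      refine fun he => hij (Fin.succAbove_left_injective (funext fun k => c.injective ?_))
      exact (RelEmbedding.ext_iff.1 he k).symm
    · simp
  · intro c' _ hne
    rw [Finsupp.smul_apply, Finsupp.finsetSum_apply]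
    by_cases hc : z c' = 0
    · rw [hc, zero_smul]
    · rw [Finset.sum_eq_zero, smul_zero]
      intro i _
      rw [Finsupp.smul_apply, Finsupp.single_eq_of_ne, smul_zero]
      exact fun he => hc (h c' hne i he.symm)
  · intro hc
    rw [Finsupp.notMem_support_iff.1 hc, zero_smul, Finsupp.zero_apply]

/-- The chain of splittings of `ω` whose members have a single nontrivial block, formed by a
final segment of the word `ω`. -/
def flagChain {m : ℕ} (ω : Equiv.Perm (Fin (m + 2))) :
    Fin m ↪o ProperPart (PartitionLattice (m + 2)) :=
  (splitChain ω 1).trans (properInclusion ω)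

theorem flagChain_rel_iff {m : ℕ} (ω : Equiv.Perm (Fin (m + 2))) (i : Fin m) {u v : Fin (m + 2)} :
    (flagChain ω i).1 u v ↔ u = v ∨ (m ≤ i + ω.symm u ∧ m ≤ i + ω.symm v) := by
  have hrel : (flagChain ω i).1 u v ↔ ∀ s : Fin (m + 1), (i : ℕ) + s < m →
    ((ω.symm u : ℕ) ≤ s ↔ (ω.symm v : ℕ) ≤ s) := Iff.rfl
  have hi := i.isLt
  have hu := (ω.symm u).isLt
  have hv := (ω.symm v).isLt
  rw [hrel, ← ω.symm.injective.eq_iff, Fin.ext_iff]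
  constructor
  · intro h
    by_contra! hne
    have h1 : ∀ k < m + 1, (i : ℕ) + k < m → ((ω.symm u : ℕ) ≤ k ↔ (ω.symm v : ℕ) ≤ k) :=
      fun k hk => h ⟨k, hk⟩
    have h2 := h1 (ω.symm u)
    have h3 := h1 (ω.symm v)
    omega
  · intro h s hs
    omega

/-- The block of the letter `a` in the partition `r`. -/
def block {n : ℕ} (a : Fin n) (r : PartitionLattice n) : Set (Fin n) := {u | r a u}

theorem mem_block_self {n : ℕ} (a : Fin n) (r : PartitionLattice n) : a ∈ block a r := r.refl a

theorem block_mono {n : ℕ} (a : Fin n) : Monotone (block a) := fun _ _ h _ hu => h hu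

/-- If `a` has the same block `A` in `x` and in `y`, then `A` is a union of blocks of both, hence of
their join. -/
theorem block_sup_le {n : ℕ} {a : Fin n} {x y : PartitionLattice n} {A : Set (Fin n)}
    (hx : block a x = A) (hy : block a y = A) : block a (x ⊔ y) ⊆ A := by
  have key : ∀ w : PartitionLattice n, block a w = A → w ≤ Setoid.ker (· ∈ A) := by
    rintro w rfl u v huv
    exact propext ⟨fun h => w.trans h huv, fun h => w.trans h (w.symm huv)⟩
  intro u hu
  have h1 : (a ∈ A) = (u ∈ A) := (sup_le (key x hx) (key y hy)) hu
  exact h1 ▸ hx ▸ mem_block_self a x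

theorem block_ne_univ {n : ℕ} {a : Fin n} {r : PartitionLattice n} (h : r ≠ ⊤) :
    block a r ≠ Set.univ := fun he => h (top_le_iff.1 fun u v _ => by
  have key : ∀ w, r a w := fun w => (he ▸ Set.mem_univ w : w ∈ block a r)
  exact r.trans (r.symm (key u)) (key v))

/-- The partition with at most one nontrivial block, the set `A`. -/
@[reducible]
def single {n : ℕ} (A : Set (Fin n)) : PartitionLattice n where
  r u v := u = v ∨ u ∈ A ∧ v ∈ A
  iseqv := ⟨fun _ => Or.inl rfl, by tauto, by
    rintro u v w (rfl | h) (rfl | h') <;> tauto⟩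

theorem single_block_le {n : ℕ} (a : Fin n) (r : PartitionLattice n) : single (block a r) ≤ r := by
  rintro u v (rfl | ⟨h, h'⟩)
  exacts [r.refl u, r.trans (r.symm h) h']

theorem single_block_lt {n : ℕ} {a : Fin n} {r s : PartitionLattice n}
    (h : block a r ⊂ block a s) : single (block a r) < single (block a s) := by
  obtain ⟨u, hu, hu'⟩ := Set.exists_of_ssubset h
  refine lt_of_le_not_ge ?_ fun hle => hu' ?_
  · rintro u v (rfl | h')
    exacts [Or.inl rfl, Or.inr ⟨h.subset h'.1, h.subset h'.2⟩]
  · rcases hle (Or.inr ⟨mem_block_self a s, hu⟩ : single (block a s) a u) with rfl | h'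
    exacts [mem_block_self a r, h'.2]

section Growth

variable {m : ℕ} {c : Fin m ↪o ProperPart (PartitionLattice (m + 2))} {a : Fin (m + 2)}

/-- If the block of `a` grows at every step of a maximal chain, then every partition in the chain
has at most one nontrivial block: the partitions keeping only the block of `a` form a chain which
is at least as long. -/
theorem extend_eq_single (h : ∀ k ≤ m, block a (extend c k) ⊂ block a (extend c (k + 1)))
    {k : ℕ} (hk : k ≤ m + 1) : extend c k = single (block a (extend c k)) := by
  have key : ∀ k ≤ m + 1, k ≤ rank (single (block a (extend c k))) := fun k => by
    induction k with
    | zero => exact fun _ => Nat.zero_le _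
    | succ k ih =>
      intro hk
      have := rank_strictMono _ (single_block_lt (h k (by omega)))
      have := ih (by omega)
      omega
  by_contra hne
  have h1 := rank_strictMono _ (lt_of_le_of_ne (single_block_le a _) (Ne.symm hne))
  rw [rank_extend c hk] at h1
  exact absurd (key k hk) (by omega)

theorem exists_eq_flagChain (h : ∀ k ≤ m, block a (extend c k) ⊂ block a (extend c (k + 1))) :
    ∃ ω : Equiv.Perm (Fin (m + 2)), ω (Fin.last (m + 1)) = a ∧ c = flagChain ω := by
  classical
  have hmono : ∀ {k l : ℕ}, k ≤ l → l ≤ m + 1 →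
      block a (extend c k) ⊆ block a (extend c l) := fun {k l} hkl => by
    induction l, hkl using Nat.le_induction with
    | base => exact fun _ => subset_rfl
    | succ l _ ih => exact fun hl => (ih (by omega)).trans (h l (by omega)).subset
  -- `g u` is the first position of the chain at which `u` lies in the block of `a`.
  have hex : ∀ u, ∃ k, u ∈ block a (extend c k) := fun u => ⟨m + 1, by
    rw [extend_last]; trivial⟩
  have hle : ∀ u, Nat.find (hex u) ≤ m + 1 := fun u => Nat.find_min' _ (by
    rw [extend_last]; trivial)
  let g : Fin (m + 2) → Fin (m + 2) := fun u => ⟨Nat.find (hex u), Nat.lt_succ_of_le (hle u)⟩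
  have hg : ∀ u k, k ≤ m + 1 → (u ∈ block a (extend c k) ↔ (g u : ℕ) ≤ k) := fun u k hk =>
    ⟨fun hu => Nat.find_min' _ hu, fun hu => hmono hu hk (Nat.find_spec (hex u))⟩
  have hga : g a = 0 := Fin.ext (Nat.le_zero.1 ((hg a 0 (by omega)).1 (mem_block_self a _)))
  have hsurj : Function.Surjective g := fun k => by
    rcases k with ⟨k, hk⟩
    cases k with
    | zero => exact ⟨a, hga⟩
    | succ k =>
      obtain ⟨u, hu, hu'⟩ := Set.exists_of_ssubset (h k (by omega))
      rw [hg _ _ (by omega)] at hu hu'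
      exact ⟨u, Fin.ext (show (g u : ℕ) = k + 1 by omega)⟩
  let e := Equiv.ofBijective g (Finite.injective_iff_surjective.2 hsurj |> fun hi => ⟨hi, hsurj⟩)
  refine ⟨(e.trans Fin.revPerm).symm, ?_, RelEmbedding.ext fun i => Subtype.ext ?_⟩
  · rw [Equiv.symm_apply_eq]
    change _ = Fin.rev (g a)
    rw [hga, Fin.rev_zero]
  · have hi := i.isLt
    rw [← extend_succ, extend_eq_single h (by omega)]
    refine Setoid.ext fun u v => ?_
    have hω : ∀ u, (((e.trans Fin.revPerm).symm.symm u : Fin _) : ℕ) = m + 1 - g u := fun u => by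
      change ((Fin.rev (g u) : Fin _) : ℕ) = _
      rw [Fin.val_rev]; omega
    rw [flagChain_rel_iff, hω, hω]
    change (u = v ∨ u ∈ block a (extend c (i + 1)) ∧ v ∈ block a (extend c (i + 1))) ↔ _
    rw [hg _ _ (by omega), hg _ _ (by omega)]
    have := (g u).isLt
    have := (g v).isLt
    omega

/-- If the block of `a` does not grow at some step of a maximal chain, then there is such a step
followed by one at which it grows. -/
theorem exists_block_eq_of_not_growth
    (h : ¬ ∀ k ≤ m, block a (extend c k) ⊂ block a (extend c (k + 1))) :
    ∃ j : Fin m, block a (extend c j) = block a (extend c (j + 1)) ∧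
      block a (extend c (j + 1)) ≠ block a (extend c (j + 2)) := by
  push Not at h
  obtain ⟨k, hk, hk'⟩ := h
  have hk'' : block a (extend c k) = block a (extend c (k + 1)) :=
    (block_mono a (extend_lt_succ c hk).le).eq_of_not_ssubset hk'
  have hlast : block a (extend c m) ≠ block a (extend c (m + 1)) := by
    rw [extend_last]
    exact block_ne_univ (lt_top_iff_ne_top.1 (extend_last c ▸ extend_lt_succ c le_rfl))
  by_contra! hcon
  have key : ∀ l, k ≤ l → l ≤ m → block a (extend c l) = block a (extend c (l + 1)) := by
    intro l hkl
    induction l, hkl using Nat.le_induction with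
    | base => exact fun _ => hk''
    | succ l _ ih => exact fun hl => hcon ⟨l, hl⟩ (ih (by omega))
  exact hlast (key m hk le_rfl)

/-- The two middle elements of an interval of length two cannot both leave the block of `a`
unchanged if the top of the interval enlarges it: their join would lie strictly in between. -/
theorem block_ssubset_of_ne {c' : Fin m ↪o ProperPart (PartitionLattice (m + 2))} {j : Fin m}
    (hne : c' j ≠ c j) (hp : extend c' j = extend c j) (hq : extend c' (j + 2) = extend c (j + 2))
    (h1 : block a (extend c j) = block a (extend c (j + 1)))
    (h2 : block a (extend c (j + 1)) ≠ block a (extend c (j + 2))) :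
    block a (extend c (j + 1)) ⊂ block a (extend c' (j + 1)) := by
  have hj := j.isLt
  refine Set.ssubset_iff_subset_ne.2 ⟨?_, fun he => ?_⟩
  · rw [← h1, ← hp]
    exact block_mono a (extend_lt_succ c' (by omega)).le
  · have hle : extend c (j + 1) ⊔ extend c' (j + 1) ≤ extend c (j + 2) :=
      sup_le (extend_lt_succ c (by omega)).le (hq ▸ (extend_lt_succ c' (by omega)).le)
    have hlt := lt_of_le_of_ne hle fun h => h2
      ((block_mono a (extend_lt_succ c (by omega)).le).antisymm (h ▸ block_sup_le rfl he.symm))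
    have hr := rank_extend c (show (j : ℕ) + 1 ≤ m + 1 by omega)
    have hr' := rank_extend c' (show (j : ℕ) + 1 ≤ m + 1 by omega)
    have hlt' : extend c (j + 1) < extend c (j + 1) ⊔ extend c' (j + 1) := by
      refine lt_of_le_of_ne le_sup_left fun h => ?_
      have hyx : extend c' (j + 1) ≤ extend c (j + 1) := sup_eq_left.1 h.symm
      rcases hyx.eq_or_lt with h' | h'
      · rw [extend_succ, extend_succ] at h'
        exact hne (Subtype.ext h')
      · have := rank_strictMono _ h'
        omega
    have := rank_strictMono _ hlt
    have := rank_strictMono _ hlt'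
    have := rank_extend c (show (j : ℕ) + 2 ≤ m + 1 by omega)
    omega

/-- A top-dimensional cycle of the partition lattice is determined by its coefficients on the
flag chains growing from a fixed letter `a`. Among the chains in the support of a counterexample,
one that maximizes the total size of the blocks of `a` leads to a contradiction. -/
theorem eq_zero_of_apply_flagChain_eq_zero {z : Chains (ProperPart (PartitionLattice (m + 2))) m}
    (hz : z ∈ cycles _ m) (a : Fin (m + 2))
    (h : ∀ ω : Equiv.Perm (Fin (m + 2)), ω (Fin.last (m + 1)) = a → z (flagChain ω) = 0) :
    z = 0 := by
  by_contra hne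
  obtain ⟨c, hc, hmax⟩ := Finset.exists_max_image z.support
    (fun c => ∑ i, (block a (c i).1).ncard) (Finsupp.support_nonempty_iff.2 hne)
  rw [Finsupp.mem_support_iff] at hc
  by_cases hgrow : ∀ k ≤ m, block a (extend c k) ⊂ block a (extend c (k + 1))
  · obtain ⟨ω, hω, rfl⟩ := exists_eq_flagChain hgrow
    exact hc (h ω hω)
  obtain ⟨j, h1, h2⟩ := exists_block_eq_of_not_growth hgrow
  cases m with
  | zero => exact j.elim0
  | succ m =>
    refine hc (apply_eq_zero_of_forall_ne hz c j fun c' hne' i hi => ?_)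
    have hface : ∀ k, c' (i.succAbove k) = c (j.succAbove k) := fun k => RelEmbedding.ext_iff.1 hi k
    -- Comparing ranks shows that the common face omits the same position in both chains.
    have hij : i = j := Fin.succAbove_left_injective (funext fun k => Fin.ext (by
      have e1 := rank_extend c' (k := (i.succAbove k : Fin _) + 1) (by omega)
      have e2 := rank_extend c (k := (j.succAbove k : Fin _) + 1) (by omega)
      rw [extend_succ] at e1 e2
      rw [hface] at e1
      omega))
    subst hij
    have hagree : ∀ k, k ≠ i → c' k = c k := fun k hk => by
      obtain ⟨l, rfl⟩ := Fin.exists_succAbove_eq hk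
      exact hface l
    have hext : ∀ l : ℕ, l ≠ i + 1 → extend c' l = extend c l := fun l hl => by
      cases l with
      | zero => rfl
      | succ l =>
        by_cases hlm : l < m + 1
        · have := extend_succ c ⟨l, hlm⟩
          have h' := extend_succ c' ⟨l, hlm⟩
          rw [hagree _ fun e => hl (by rw [← e]), ← this] at h'
          exact h'
        · rw [extend_succ_of_le _ (not_lt.1 hlm), extend_succ_of_le _ (not_lt.1 hlm)]
    have hi' : c' i ≠ c i := fun e => hne' (RelEmbedding.ext fun k => by
      by_cases hk : k = i
      · rw [hk, e]
      · exact hagree k hk)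
    have hlt := block_ssubset_of_ne hi' (hext _ (by omega)) (hext _ (by omega)) h1 h2
    rw [extend_succ, extend_succ] at hlt
    by_contra hz'
    refine (hmax c' (Finsupp.mem_support_iff.2 hz')).not_gt
      (Finset.sum_lt_sum (fun k _ => ?_) ⟨i, Finset.mem_univ _, Set.ncard_lt_ncard hlt⟩)
    rcases eq_or_ne k i with rfl | hk
    · exact Set.ncard_le_ncard hlt.subset
    · rw [hagree k hk]

end Growth

/-! ### Evaluating cycles of splittings on flag chains -/

section Evaluation

variable {m : ℕ}

/-- In a splitting of `ω` the block of the last letter is a final segment of the word `ω`; hence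
the order of the letters of `ω` can be recovered from a flag chain consisting of splittings
of `ω`. -/
theorem eq_of_flagChain_eq_trans {ω ω' : Equiv.Perm (Fin (m + 2))}
    (hlast : ω' (Fin.last (m + 1)) = ω (Fin.last (m + 1)))
    {d : Fin m ↪o ProperPart (SplitPoset ω)} (h : flagChain ω' = d.trans (properInclusion ω)) :
    ω' = ω := by
  have ha : ω.symm (ω' (Fin.last (m + 1))) = Fin.last (m + 1) := by
    rw [hlast, Equiv.symm_apply_apply]
  have hmono : StrictMono (ω'.trans ω.symm) := by
    intro l k hlk
    change ω.symm (ω' l) < ω.symm (ω' k)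
    have hlk' : (l : ℕ) < k := hlk
    have hk := k.isLt
    rcases Nat.eq_or_lt_of_le (Nat.lt_succ_iff.1 hk) with hkm | hkm
    · obtain rfl : k = Fin.last (m + 1) := Fin.ext hkm
      rw [ha]
      refine lt_of_le_of_ne (Fin.le_last _) fun e => hlk.ne ?_
      exact ω'.injective (ω.symm.injective (e.trans ha.symm))
    · -- `ω' k` lies in the block of the last letter at position `m - k` of the chain, but `ω' l`
      -- does not.
      set i : Fin m := ⟨m - k, by omega⟩ with hi
      have hin : (flagChain ω' i).1 (ω' (Fin.last (m + 1))) (ω' k) :=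
        (flagChain_rel_iff ω' i).2 (Or.inr (by
          simp only [Equiv.symm_apply_apply, Fin.val_last, hi]; omega))
      have hnot : ¬ (flagChain ω' i).1 (ω' (Fin.last (m + 1))) (ω' l) := by
        rw [flagChain_rel_iff, ω'.injective.eq_iff, Fin.ext_iff]
        simp only [Equiv.symm_apply_apply, Fin.val_last, hi]
        omega
      by_contra! hle
      refine hnot ?_
      have hfi : (flagChain ω' i).1 = (d i).1.1 := by rw [h]; rfl
      rw [hfi] at hin ⊢
      obtain ⟨S, hS⟩ := (d i).1.2
      rw [← hS] at hin ⊢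
      intro s hs
      have h1 := hin s hs
      have hs' := s.isLt
      have hle' : (ω.symm (ω' k) : ℕ) ≤ ω.symm (ω' l) := hle
      rw [ha, Fin.val_last] at h1 ⊢
      omega
  have hid : ∀ k, ω.symm (ω' k) = k := fun k =>
    congrFun ((hmono.range_inj strictMono_id).1 (by
      rw [Set.range_id, (ω'.trans ω.symm).range_eq_univ])) k
  exact Equiv.ext fun k => (ω.symm_apply_eq.1 (hid k))

theorem chainsMap_apply_eq_zero {ω ω' : Equiv.Perm (Fin (m + 2))}
    (hlast : ω' (Fin.last (m + 1)) = ω (Fin.last (m + 1))) (hne : ω' ≠ ω)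
    (w : Chains (ProperPart (SplitPoset ω)) m) :
    chainsMap (properInclusion ω) m w (flagChain ω') = 0 :=
  Finsupp.mapDomain_of_notMem_range _ _ fun ⟨_, hd⟩ => hne (eq_of_flagChain_eq_trans hlast hd.symm)

theorem trans_injective {P Q : Type*} [PartialOrder P] [PartialOrder Q] (f : P ↪o Q) (m : ℕ) :
    Function.Injective fun c : Fin m ↪o P => c.trans f := fun _ _ h =>
  RelEmbedding.ext fun i => f.injective (RelEmbedding.ext_iff.1 h i)

theorem chainsMap_apply_flagChain (ω : Equiv.Perm (Fin (m + 2)))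
    (w : Chains (ProperPart (SplitPoset ω)) m) :
    chainsMap (properInclusion ω) m w (flagChain ω) = w (splitChain ω 1) :=
  Finsupp.mapDomain_apply (trans_injective _ m) w _

/-- A cycle of splittings of `ω` is determined by a single coefficient. -/
theorem eq_zero_of_apply_splitChain_eq_zero {ω : Equiv.Perm (Fin (m + 2))}
    {w : Chains (ProperPart (SplitPoset ω)) m} (hw : w ∈ cycles _ m)
    (h : w (splitChain ω 1) = 0) : w = 0 := by
  refine Finsupp.mapDomain_injective (trans_injective (properInclusion ω) m) ?_
  rw [Finsupp.mapDomain_zero]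
  refine eq_zero_of_apply_flagChain_eq_zero (chainsMap_mem_cycles _ m w hw)
    (ω (Fin.last (m + 1))) fun ω' hω' => ?_
  rcases eq_or_ne ω' ω with rfl | hne
  · exact (chainsMap_apply_flagChain _ w).trans h
  · exact chainsMap_apply_eq_zero hω' hne w

end Evaluation

/-! ### Homology in the top dimension -/

section Homology

variable {P : Type*} [PartialOrder P] {m : ℕ}

theorem boundaries_eq_bot [IsEmpty (Fin (m + 1) ↪o P)] : boundaries P m = ⊥ := by
  rw [boundaries, LinearMap.range_eq_bot]
  exact Subsingleton.elim _ _

/-- The coefficient of a homology class at a chain `c`; it is well defined in the top dimension,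
where there are no nonzero boundaries. -/
noncomputable def coeff [IsEmpty (Fin (m + 1) ↪o P)] (c : Fin m ↪o P) :
    ReducedHomology P m →ₗ[ℤ] ℤ :=
  Submodule.liftQ _ ((Finsupp.lapply c).comp (cycles P m).subtype) (by
    rintro ⟨x, _⟩ hx
    have hx' : x ∈ boundaries P m := hx
    rw [boundaries_eq_bot, Submodule.mem_bot] at hx'
    subst hx'
    exact LinearMap.map_zero _)

theorem coeff_mk [IsEmpty (Fin (m + 1) ↪o P)] (c : Fin m ↪o P) (z : cycles P m) :
    coeff c (Submodule.Quotient.mk z) = z.1 c := rfl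

theorem isUnit_of_isFundamentalCycle {z : ReducedHomology P m} (hz : IsFundamentalCycle z)
    (e : ReducedHomology P m ≃ₗ[ℤ] ℤ) : IsUnit (e z) := by
  obtain ⟨e', he'⟩ := hz
  have h : e z * e' (e.symm 1) = 1 := by
    have h1 : e'.symm 1 = z := by rw [← he', LinearEquiv.symm_apply_apply]
    have h2 : e.symm 1 = e' (e.symm 1) • z := by
      rw [← h1, ← map_smul, smul_eq_mul, mul_one, LinearEquiv.symm_apply_apply]
    have h3 := congrArg e h2
    rw [LinearEquiv.apply_symm_apply, map_smul, smul_eq_mul] at h3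
    rw [mul_comm]
    exact h3.symm
  exact IsUnit.of_mul_eq_one _ h

end Homology

instance isEmpty_chain_partitionLattice (m : ℕ) :
    IsEmpty (Fin (m + 1) ↪o ProperPart (PartitionLattice (m + 2))) :=
  ⟨fun c => absurd (length_le c) (by omega)⟩

instance isEmpty_chain_splitPoset {m : ℕ} (ω : Equiv.Perm (Fin (m + 2))) :
    IsEmpty (Fin (m + 1) ↪o ProperPart (SplitPoset ω)) :=
  ⟨fun c => isEmptyElim (c.trans (properInclusion ω))⟩

/-- The top homology of the poset of splittings of `ω` is infinite cyclic, by evaluation at the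
chain whose members merge a final segment of `ω`. -/
noncomputable def splitHomologyEquiv {m : ℕ} (ω : Equiv.Perm (Fin (m + 2))) :
    ReducedHomology (ProperPart (SplitPoset ω)) m ≃ₗ[ℤ] ℤ :=
  LinearEquiv.ofBijective (coeff (splitChain ω 1)) (by
    constructor
    · refine (injective_iff_map_eq_zero _).2 fun x hx => ?_
      induction x using Submodule.Quotient.induction_on with
      | _ w =>
        rw [coeff_mk] at hx
        rw [show w = 0 from Subtype.ext (eq_zero_of_apply_splitChain_eq_zero w.2 hx)]
        exact Submodule.Quotient.mk_zero _
    · intro k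
      refine ⟨k • Submodule.Quotient.mk ⟨splitCycle ω, splitCycle_mem_cycles ω⟩, ?_⟩
      rw [map_smul, coeff_mk, splitCycle_apply_one, smul_eq_mul, mul_one])

theorem coeff_flagChain_homologyMap {m : ℕ} (ω : Equiv.Perm (Fin (m + 2)))
    (x : ReducedHomology (ProperPart (SplitPoset ω)) m) :
    coeff (flagChain ω) (homologyMap (properInclusion ω) m x) = splitHomologyEquiv ω x := by
  induction x using Submodule.Quotient.induction_on with
  | _ w => exact chainsMap_apply_flagChain ω w.1

theorem coeff_flagChain_homologyMap_of_ne {m : ℕ} {ω ω' : Equiv.Perm (Fin (m + 2))}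
    (hlast : ω' (Fin.last (m + 1)) = ω (Fin.last (m + 1))) (hne : ω' ≠ ω)
    (x : ReducedHomology (ProperPart (SplitPoset ω)) m) :
    coeff (flagChain ω') (homologyMap (properInclusion ω) m x) = 0 := by
  induction x using Submodule.Quotient.induction_on with
  | _ w => exact chainsMap_apply_eq_zero hlast hne w.1

/-- The fundamental cycles of the words ending in a fixed letter `a` give a basis. -/
theorem exists_basis {m : ℕ} (a : Fin (m + 2))
    (ρ : (ω : Equiv.Perm (Fin (m + 2))) → ReducedHomology (ProperPart (SplitPoset ω)) m)
    (hρ : ∀ ω, IsFundamentalCycle (ρ ω)) :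
    ∃ b : Module.Basis {ω : Equiv.Perm (Fin (m + 2)) // ω (Fin.last (m + 1)) = a} ℤ
        (ReducedHomology (ProperPart (PartitionLattice (m + 2))) m),
      ∀ ω, b ω = homologyMap (properInclusion ω.1) m (ρ ω.1) := by
  classical
  let ι := {ω : Equiv.Perm (Fin (m + 2)) // ω (Fin.last (m + 1)) = a}
  let v : ι → ReducedHomology (ProperPart (PartitionLattice (m + 2))) m :=
    fun ω => homologyMap (properInclusion ω.1) m (ρ ω.1)
  let E : ReducedHomology (ProperPart (PartitionLattice (m + 2))) m →ₗ[ℤ] (ι → ℤ) :=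
    LinearMap.pi fun ω => coeff (flagChain ω.1)
  choose u hu using fun ω => isUnit_of_isFundamentalCycle (hρ ω) (splitHomologyEquiv ω)
  have hE : Function.Injective E := by
    refine (injective_iff_map_eq_zero _).2 fun x hx => ?_
    induction x using Submodule.Quotient.induction_on with
    | _ z =>
      rw [show z = 0 from Subtype.ext (eq_zero_of_apply_flagChain_eq_zero z.2 a
        fun ω hω => congrFun hx ⟨ω, hω⟩)]
      exact Submodule.Quotient.mk_zero _
  have hv : ∀ ω : ι, E (v ω) = Pi.single ω (u ω.1 : ℤ) := fun ω => funext fun ω' => by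
    rcases eq_or_ne ω' ω with rfl | hne
    · rw [Pi.single_eq_same, hu]
      exact coeff_flagChain_homologyMap _ _
    · rw [Pi.single_eq_of_ne hne]
      exact coeff_flagChain_homologyMap_of_ne (ω'.2.trans ω.2.symm)
        (fun h => hne (Subtype.ext h)) _
  let b₀ := (Pi.basisFun ℤ ι).isUnitSMul (w := fun ω => (u ω.1 : ℤ)) fun ω => (u ω.1).isUnit
  have hb₀ : ∀ ω, b₀ ω = E (v ω) := fun ω => by
    rw [Module.Basis.isUnitSMul_apply, Pi.basisFun_apply, hv, ← Pi.single_smul, smul_eq_mul,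
      mul_one]
  have hsurj : Function.Surjective E := by
    rw [← LinearMap.range_eq_top, eq_top_iff, ← b₀.span_eq, Submodule.span_le]
    rintro _ ⟨ω, rfl⟩
    exact ⟨v ω, (hb₀ ω).symm⟩
  refine ⟨b₀.map (LinearEquiv.ofBijective E ⟨hE, hsurj⟩).symm, fun ω => ?_⟩
  rw [Module.Basis.map_apply, hb₀, LinearEquiv.symm_apply_eq]
  rfl

end SplittingBasis

theorem theorem6p3 (n : ℕ) (hn : 2 ≤ n) :
    (∀ ω : Equiv.Perm (Fin n),
      ∃ z : SplittingBasis.ReducedHomology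
          (SplittingBasis.ProperPart (SplittingBasis.SplitPoset ω)) (n - 2),
        SplittingBasis.IsFundamentalCycle z) ∧
    ∀ ρ : (ω : Equiv.Perm (Fin n)) →
        SplittingBasis.ReducedHomology
          (SplittingBasis.ProperPart (SplittingBasis.SplitPoset ω)) (n - 2),
      (∀ ω, SplittingBasis.IsFundamentalCycle (ρ ω)) →
      ∃ b : Module.Basis
          {ω : Equiv.Perm (Fin n) // ω ⟨n - 1, by omega⟩ = ⟨n - 1, by omega⟩} ℤ
          (SplittingBasis.ReducedHomology
            (SplittingBasis.ProperPart (SplittingBasis.PartitionLattice n)) (n - 2)),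
        ∀ ω, b ω =
          SplittingBasis.homologyMap (SplittingBasis.properInclusion ω.1) (n - 2) (ρ ω.1) := by
  obtain ⟨m, rfl⟩ := Nat.exists_eq_add_of_le' hn
  exact ⟨fun ω => ⟨(SplittingBasis.splitHomologyEquiv ω).symm 1,
      SplittingBasis.splitHomologyEquiv ω, LinearEquiv.apply_symm_apply _ _⟩,
    fun ρ hρ => SplittingBasis.exists_basis (Fin.last (m + 1)) ρ hρ⟩
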